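/- Let $D^4\subset\mathbb R^4$ be the closed unit ball, and let $\Sigma$ be a smooth surface (a smooth $2$-manifold, with or without boundary). Let $j,j':\Sigma\to D^4$ be smooth embeddings, and suppose that there is a smooth diffeomorphism $\alpha:D^4\to D^4$ that is the identity on $\partial D^4$ and satisfies $j'=\alpha\circ j$. Then $j$ and $j'$ are smoothly isotopic rel boundary: there are a smooth diffeomorphism $\beta:D^4\to D^4$ with $j'=\beta\circ j$ and a level-preserving smooth diffeomorphism $G:[0,1]\times D^4\to[0,1]\times D^4$, $G(t,z)=(t,G_t(z))$, such that $G_0=\mathrm{id}$, $G_1=\beta$, and $G_t(z)=z$ for all $t\in[0,1]$ and $z\in\partial D^4$. -/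

import Mathlib

open scoped ContDiff Manifold

/-- Euclidean `4`-space. -/
abbrev R4 : Type := EuclideanSpace ℝ (Fin 4)

/-- The closed unit ball `D⁴` in Euclidean `4`-space. -/
def D4 : Set R4 := Metric.closedBall 0 1

/-- The boundary `∂D⁴`, i.e. the unit sphere in Euclidean `4`-space. -/
def bdryD4 : Set R4 := Metric.sphere 0 1

/-- `f` restricts to a smooth diffeomorphism from `s` onto `t`, where `s` and `t` are subsets of
normed spaces. It is used only for the convex bodies `D⁴` and `[0,1] × D⁴`; there `ContDiffOn ℝ ∞`
is smoothness up to the boundary (and the corners). Values of `f` outside `s` are irrelevant. -/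
structure IsSmoothDiffeo {E F : Type*} [NormedAddCommGroup E] [NormedSpace ℝ E]
    [NormedAddCommGroup F] [NormedSpace ℝ F] (s : Set E) (t : Set F) (f : E → F) : Prop where
  bijOn : Set.BijOn f s t
  contDiffOn : ContDiffOn ℝ ∞ f s
  contDiffOn_inv : ∃ g : F → E, Set.InvOn g f s t ∧ ContDiffOn ℝ ∞ g t

/-- `β : D⁴ → D⁴` is smoothly isotopic to the identity rel boundary: there is a level-preserving
diffeomorphism `G (t, z) = (t, G_t z)` of `[0,1] × D⁴` with `G_0 = id` and `G_1 = β`, and with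
every `G_t` the identity on `∂D⁴`. -/
def IsotopicToIdRelBdry (β : R4 → R4) : Prop :=
  ∃ G : ℝ × R4 → ℝ × R4,
    IsSmoothDiffeo (Set.Icc (0 : ℝ) 1 ×ˢ D4) (Set.Icc (0 : ℝ) 1 ×ˢ D4) G ∧
    (∀ t ∈ Set.Icc (0 : ℝ) 1, ∀ z ∈ D4, (G (t, z)).1 = t) ∧
    (∀ z ∈ D4, G (0, z) = (0, z)) ∧
    (∀ z ∈ D4, G (1, z) = (1, β z)) ∧
    (∀ t ∈ Set.Icc (0 : ℝ) 1, ∀ z ∈ bdryD4, G (t, z) = (t, z))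

/-- Two maps `j, j' : S → D⁴` are isotopic rel boundary: `j' = β ∘ j` for a diffeomorphism `β` of
`D⁴` that is smoothly isotopic to the identity rel boundary. -/
def IsotopicRelBdry {S : Type*} (j j' : S → R4) : Prop :=
  ∃ β : R4 → R4, IsSmoothDiffeo D4 D4 β ∧ IsotopicToIdRelBdry β ∧ ∀ x, j' x = β (j x)

/-- `j` is a smooth embedding of the manifold `S` in `D⁴`: a smooth embedding in Euclidean
`4`-space (an immersion that is a homeomorphism onto its image) with image contained in `D⁴`.
Parts of the image may lie in `∂D⁴`, as for properly embedded surfaces with boundary. -/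
structure IsEmbeddingInD4 {E H S : Type*} [NormedAddCommGroup E] [NormedSpace ℝ E]
    [TopologicalSpace H] (I : ModelWithCorners ℝ E H) [TopologicalSpace S] [ChartedSpace H S]
    (j : S → R4) : Prop where
  isSmoothEmbedding : Manifold.IsSmoothEmbedding I 𝓘(ℝ, R4) ∞ j
  mem_D4 : ∀ x, j x ∈ D4

/-! The isotopy is an Alexander trick carried out in the complement of the surface. Its two
obstacles are that `α` need not be the identity near the sphere, and that shrinking the ball to a
point is not smooth.

For the first, `α` is deformed rel boundary through `h t z = z + (1 - t * χ (1 - ‖z‖ ^ 2)) • (α z -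
z)`, with `χ = 1` near `0`, so that `h 0 = α` and `h 1` is the identity near the sphere. On the
sphere the derivative of `α - id` kills tangent vectors and that of `α` keeps the inward normal
pointing inward, so every convex combination of `id` and the derivative of `α` is injective. Taking
`χ` with `u * |χ' u|` small makes the derivative of the cutoff harmless, and all `h t` are uniformly
antilipschitz (`exists_cutoff_antilipschitz`); they are therefore diffeomorphisms
(`isSmoothDiffeo_of_antilipschitz`, `surjOn_closedBall_of_antilipschitz`).

For the second, a surface in dimension four misses a ball of centre `p` and radius `r`
(`IsEmbeddingInD4.exists_ball_disjoint`), and it is enough to shrink to that ball. Extend `h 1` by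
the identity to `e`, and let `γ t` be the conjugate of `e⁻¹` by an affine map taking the unit ball
to a ball that shrinks to this one (`shrink`). Then `γ 0 = e⁻¹`, while `γ 1` fixes the surface
pointwise. With `β = α ∘ γ 1` one has `β ∘ j = α ∘ j = j'`, and `G t = α ∘ (h t)⁻¹ ∘ h 1 ∘ γ t` runs
from `id` to `β`. -/

open Set Filter Topology

/-! ### Formal properties of diffeomorphisms between sets. -/

namespace IsSmoothDiffeo

variable {E F G : Type*} [NormedAddCommGroup E] [NormedSpace ℝ E] [NormedAddCommGroup F]
  [NormedSpace ℝ F] [NormedAddCommGroup G] [NormedSpace ℝ G]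

theorem comp {s : Set E} {t : Set F} {u : Set G} {f : E → F} {g : F → G}
    (hg : IsSmoothDiffeo t u g) (hf : IsSmoothDiffeo s t f) : IsSmoothDiffeo s u (g ∘ f) := by
  obtain ⟨f', hf', hf's⟩ := hf.contDiffOn_inv
  obtain ⟨g', hg', hg's⟩ := hg.contDiffOn_inv
  have hg'm : MapsTo g' u t := (hg.bijOn.symm hg'.symm).mapsTo
  exact ⟨hg.bijOn.comp hf.bijOn, hg.contDiffOn.comp hf.contDiffOn hf.bijOn.mapsTo,
    f' ∘ g', hf'.comp hg' hf.bijOn.mapsTo hg'm, hf's.comp hg's hg'm⟩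

theorem exists_symm {s : Set E} {t : Set F} {f : E → F} (hf : IsSmoothDiffeo s t f) :
    ∃ g : F → E, InvOn g f s t ∧ IsSmoothDiffeo t s g := by
  obtain ⟨g, hg, hgs⟩ := hf.contDiffOn_inv
  exact ⟨g, hg, hf.bijOn.symm hg.symm, hgs, f, hg.symm, hf.contDiffOn⟩

theorem of_invOn {s : Set E} {t : Set F} {f : E → F} {g : F → E} (h : InvOn g f s t)
    (hf : MapsTo f s t) (hg : MapsTo g t s) (hfs : ContDiffOn ℝ ∞ f s)
    (hgs : ContDiffOn ℝ ∞ g t) : IsSmoothDiffeo s t f :=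
  ⟨h.bijOn hf hg, hfs, g, h, hgs⟩

end IsSmoothDiffeo

/-! ### Inverse function theorem up to the boundary, and surjectivity on balls. -/

section InverseFunction

variable {E F : Type*} [NormedAddCommGroup E] [NormedSpace ℝ E] [NormedAddCommGroup F]
  [NormedSpace ℝ F]

theorem HasFDerivAt.le_norm_apply_of_antilipschitz {f : E → F} {f' : E →L[ℝ] F} {K : Set E}
    {c : ℝ} {p : E} (hf : HasFDerivAt f f' p) (hp : K ∈ 𝓝 p)
    (h : ∀ q ∈ K, c * ‖q - p‖ ≤ ‖f q - f p‖) (v : E) : c * ‖v‖ ≤ ‖f' v‖ := by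
  have hl : HasDerivAt (fun τ : ℝ => p + τ • v) v 0 := by
    simpa using ((hasDerivAt_id (0 : ℝ)).smul_const v).const_add p
  have hf0 : HasFDerivAt f f' (p + (0 : ℝ) • v) := by simpa using hf
  have hd := hf0.comp_hasDerivAt (0 : ℝ) hl
  have hK : ∀ᶠ τ : ℝ in 𝓝[≠] 0, p + τ • v ∈ K := by
    apply (hl.continuousAt.eventually_mem (by simpa using hp)).filter_mono nhdsWithin_le_nhds
  refine ge_of_tendsto hd.tendsto_slope.norm ?_
  filter_upwards [hK, self_mem_nhdsWithin] with τ hτ hτ0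
  have h0 : 0 < |τ| := abs_pos.2 hτ0
  have := h _ hτ
  simp only [add_sub_cancel_left, norm_smul, Real.norm_eq_abs] at this
  simp only [slope, vsub_eq_sub, sub_zero, Function.comp, zero_smul, add_zero, norm_smul, norm_inv,
    Real.norm_eq_abs]
  rw [inv_mul_eq_div, le_div_iff₀ h0]
  linarith

/-- At interior points this is the limit of difference quotients. It passes to boundary points
because the interior is dense in `K` and the derivative is continuous up to the boundary. -/
theorem le_norm_fderivWithin_of_antilipschitz {f : E → F} {K : Set E} {c : ℝ} (hK : Convex ℝ K)
    (hKi : (interior K).Nonempty) (hf : ContDiffOn ℝ 1 f K)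
    (h : ∀ p ∈ K, ∀ q ∈ K, c * ‖p - q‖ ≤ ‖f p - f q‖) {p : E} (hp : p ∈ K) (v : E) :
    c * ‖v‖ ≤ ‖fderivWithin ℝ f K p v‖ := by
  have hcl : p ∈ closure (interior K) := by
    rw [hK.closure_interior_eq_closure_of_nonempty_interior hKi]; exact subset_closure hp
  have : (𝓝[interior K] p).NeBot := mem_closure_iff_nhdsWithin_neBot.1 hcl
  have hcont : ContinuousOn (fderivWithin ℝ f K) K :=
    hf.continuousOn_fderivWithin (uniqueDiffOn_convex hK hKi) le_rfl
  have ht : Tendsto (fun q => ‖fderivWithin ℝ f K q v‖) (𝓝[interior K] p)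
      (𝓝 ‖fderivWithin ℝ f K p v‖) :=
    (((hcont p hp).mono interior_subset).clm_apply continuousWithinAt_const).norm
  refine ge_of_tendsto ht ?_
  filter_upwards [self_mem_nhdsWithin] with q hq
  have hqn : K ∈ 𝓝 q := mem_interior_iff_mem_nhds.1 hq
  have hd :=
    (hf.differentiableOn one_ne_zero q (interior_subset hq)).hasFDerivWithinAt.hasFDerivAt hqn
  exact hd.le_norm_apply_of_antilipschitz hqn (fun r hr => h r hr q (interior_subset hq)) v

variable [FiniteDimensional ℝ E]

theorem exists_continuousLinearEquiv_of_le_norm {c : ℝ} (hc : 0 < c) {A : E →L[ℝ] E}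
    (h : ∀ v, c * ‖v‖ ≤ ‖A v‖) : ∃ e : E ≃L[ℝ] E, (e : E →L[ℝ] E) = A := by
  have hinj : Function.Injective (A : E →ₗ[ℝ] E) := by
    rw [injective_iff_map_eq_zero]
    intro v hv
    have := h v
    rw [show A v = 0 from hv, norm_zero] at this
    exact norm_le_zero_iff.1 (nonpos_of_mul_nonpos_right this hc)
  refine ⟨(LinearEquiv.ofInjectiveEndo (A : E →ₗ[ℝ] E) hinj).toContinuousLinearEquiv, ?_⟩
  ext v
  simp

/-- Inverse function theorem up to the boundary, on a convex body. -/
theorem isSmoothDiffeo_of_antilipschitz {f : E → E} {K : Set E} {c : ℝ} (hK : Convex ℝ K)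
    (hKi : (interior K).Nonempty) (hf : ContDiffOn ℝ ∞ f K) (hc : 0 < c)
    (h : ∀ p ∈ K, ∀ q ∈ K, c * ‖p - q‖ ≤ ‖f p - f q‖) (hm : MapsTo f K K)
    (hs : SurjOn f K K) : IsSmoothDiffeo K K f := by
  have hud := uniqueDiffOn_convex hK hKi
  have hinj : InjOn f K := by
    intro p hp q hq hpq
    have := h p hp q hq
    rw [hpq, sub_self, norm_zero] at this
    exact sub_eq_zero.1 (norm_le_zero_iff.1 (nonpos_of_mul_nonpos_right this hc))
  have hbij : BijOn f K K := ⟨hm, hinj, hs⟩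
  set g := Function.invFunOn f K with hg
  have hinv : InvOn g f K K := hbij.invOn_invFunOn
  have hgm : MapsTo g K K := (hbij.symm hinv.symm).mapsTo
  have hgc : ContinuousOn g K := by
    have : LipschitzOnWith (Real.toNNReal c⁻¹) g K := by
      refine LipschitzOnWith.of_dist_le_mul fun p hp q hq => ?_
      have := h _ (hgm hp) _ (hgm hq)
      rw [hinv.2 hp, hinv.2 hq] at this
      rw [dist_eq_norm, dist_eq_norm, Real.coe_toNNReal _ (by positivity), inv_mul_eq_div,
        le_div_iff₀ hc]
      linarith
    exact this.continuousOn
  have hequiv : ∀ p ∈ K, ∃ e : E ≃L[ℝ] E, (e : E →L[ℝ] E) = fderivWithin ℝ f K p := fun p hp =>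
    exists_continuousLinearEquiv_of_le_norm hc fun v =>
      le_norm_fderivWithin_of_antilipschitz hK hKi (hf.of_le (by exact_mod_cast le_top)) h hp v
  have hgd : ∀ q ∈ K, HasFDerivWithinAt g
      (ContinuousLinearMap.inverse (fderivWithin ℝ f K (g q))) K q := by
    intro q hq
    obtain ⟨e, he⟩ := hequiv _ (hgm hq)
    have hfd := (hf.differentiableOn (by simp) _ (hgm hq)).hasFDerivWithinAt
    rw [← he] at hfd ⊢
    rw [ContinuousLinearMap.inverse_equiv]
    refine hfd.of_local_left_inverse ?_ hq ?_
    · exact tendsto_nhdsWithin_iff.2 ⟨hgc q hq, by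
        filter_upwards [self_mem_nhdsWithin] with r hr using hgm hr⟩
    · filter_upwards [self_mem_nhdsWithin] with r hr using hinv.2 hr
  refine ⟨hbij, hf, g, hinv, contDiffOn_infty.2 fun n => ?_⟩
  -- Bootstrap: the derivative of `g` is inversion composed with `fderivWithin ℝ f K ∘ g`, hence as
  -- regular as `g` itself.
  induction n with
  | zero => exact_mod_cast contDiffOn_zero.2 hgc
  | succ n ih =>
    push_cast
    refine (contDiffOn_succ_iff_hasFDerivWithinAt_of_uniqueDiffOn hud).2
      ⟨by simp, _, ?_, hgd⟩
    have hf' : ContDiffOn ℝ n (fderivWithin ℝ f K) K :=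
      hf.fderivWithin hud (by exact_mod_cast le_top)
    intro q hq
    obtain ⟨e, he⟩ := hequiv _ (hgm hq)
    have h1 : ContDiffAt ℝ n (ContinuousLinearMap.inverse (M := E) (M₂ := E))
        (fderivWithin ℝ f K (g q)) := by
      rw [← he]; exact contDiffAt_map_inverse e
    exact h1.comp_contDiffWithinAt q ((hf'.comp ih hgm) q hq)

/-- An antilipschitz `C¹` self-map of a closed ball which preserves the open ball and fixes the
sphere pointwise is onto. -/
theorem surjOn_closedBall_of_antilipschitz {f : E → E} {c r : ℝ} {x : E}
    (hf : ContDiffOn ℝ 1 f (Metric.closedBall x r)) (hc : 0 < c) (hr : 0 < r)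
    (h : ∀ p ∈ Metric.closedBall x r, ∀ q ∈ Metric.closedBall x r, c * ‖p - q‖ ≤ ‖f p - f q‖)
    (hm : MapsTo f (Metric.ball x r) (Metric.ball x r))
    (hb : ∀ p ∈ Metric.sphere x r, f p = p) :
    SurjOn f (Metric.closedBall x r) (Metric.closedBall x r) := by
  set B := Metric.ball x r
  set D := Metric.closedBall x r
  have hBD : B ⊆ D := Metric.ball_subset_closedBall
  have hopen : IsOpen (f '' B) := by
    rw [isOpen_iff_mem_nhds]
    rintro _ ⟨p, hp, rfl⟩
    have hpn : D ∈ 𝓝 p := mem_of_superset (Metric.isOpen_ball.mem_nhds hp) hBD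
    have hst := (hf.contDiffAt hpn).hasStrictFDerivAt one_ne_zero
    obtain ⟨e, he⟩ := exists_continuousLinearEquiv_of_le_norm hc
      (hst.hasFDerivAt.le_norm_apply_of_antilipschitz hpn (fun q hq => h q hq p (hBD hp)))
    rw [← he] at hst
    rw [← hst.map_nhds_eq_of_equiv]
    exact image_mem_map (Metric.isOpen_ball.mem_nhds hp)
  have hcl : IsClosed (f '' D) :=
    ((isCompact_closedBall x r).image_of_continuousOn hf.continuousOn).isClosed
  -- The image of `B` is open, and closed relative to `B`: a limit point in `B` has a preimage in
  -- `D`, which cannot lie on the sphere because `f` fixes the sphere. Connectedness of `B`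
  -- concludes.
  have hsub : B ⊆ f '' B := by
    refine (Metric.isPreconnected_ball).subset_of_closure_inter_subset hopen ?_ ?_
    · exact ⟨f x, hm (Metric.mem_ball_self hr), x, Metric.mem_ball_self hr, rfl⟩
    · rintro y ⟨hy, hyB⟩
      have : y ∈ f '' D := closure_minimal (image_mono hBD) hcl hy
      obtain ⟨p, hp, rfl⟩ := this
      rcases (Metric.mem_closedBall.1 hp).lt_or_eq with hlt | heq
      · exact ⟨p, hlt, rfl⟩
      · rw [hb p heq] at hyB
        exact absurd hyB (by simp [heq])
  intro y hy
  rcases (Metric.mem_closedBall.1 hy).lt_or_eq with hlt | heq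
  · exact image_mono hBD (hsub hlt)
  · exact ⟨y, hy, hb y heq⟩

end InverseFunction

/-! ### The logarithmic cutoff. -/

theorem Real.smoothTransition.exists_lipschitz :
    ∃ K : ℝ, 0 < K ∧ ∀ a b : ℝ,
      |Real.smoothTransition a - Real.smoothTransition b| ≤ K * |a - b| := by
  obtain ⟨K, hK⟩ := (Real.smoothTransition.contDiff (n := 1)).contDiffOn.exists_lipschitzOnWith
    one_ne_zero (convex_Icc (0 : ℝ) 1) isCompact_Icc
  refine ⟨K + 1, by positivity, fun a b => ?_⟩
  have h1 := hK.dist_le_mul _ (projIcc (0 : ℝ) 1 zero_le_one a).2 _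
    (projIcc (0 : ℝ) 1 zero_le_one b).2
  rw [Real.smoothTransition.projIcc, Real.smoothTransition.projIcc, Real.dist_eq,
    Real.dist_eq] at h1
  have h2 : |(projIcc (0 : ℝ) 1 zero_le_one a : ℝ) - projIcc (0 : ℝ) 1 zero_le_one b| ≤ |a - b| :=
    abs_projIcc_sub_projIcc zero_le_one
  have := mul_le_mul_of_nonneg_left h2 K.2
  have := abs_nonneg (a - b)
  simp only [NNReal.val_eq_coe] at *
  linarith

/-- A smooth cutoff whose derivative at `u` is small compared with `1 / u`. -/
theorem exists_slow_cutoff {δ η : ℝ} (hδ : 0 < δ) (hη : 0 < η) :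
    ∃ (ε : ℝ) (χ : ℝ → ℝ), 0 < ε ∧ ContDiff ℝ ∞ χ ∧ (∀ u, χ u ∈ Icc (0 : ℝ) 1) ∧
      (∀ u ≤ ε, χ u = 1) ∧ (∀ u, δ ≤ u → χ u = 0) ∧
      ∀ u v, 0 < v → v ≤ u → |χ u - χ v| * v ≤ η * (u - v) := by
  obtain ⟨K, hK, hlip⟩ := Real.smoothTransition.exists_lipschitz
  set L := K / η with hL
  have hL0 : 0 < L := by positivity
  -- In the variable `log u` the transition is stretched to length `L = K / η`, so its slope at `u`
  -- is at most `K / (L * u) = η / u`. The case `u ≤ 0` is separate because `Real.log` takes junk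
  -- values there.
  let χ : ℝ → ℝ := fun u => if u ≤ 0 then 1 else
    Real.smoothTransition ((Real.log δ - Real.log u) / L)
  have hpos : ∀ u, 0 < u → χ u = Real.smoothTransition ((Real.log δ - Real.log u) / L) :=
    fun u hu => if_neg hu.not_ge
  have hone : ∀ u ≤ δ * Real.exp (-L), χ u = 1 := by
    intro u hu
    by_cases h0 : u ≤ 0
    · exact if_pos h0
    · rw [hpos u (not_le.1 h0)]
      apply Real.smoothTransition.one_of_one_le
      rw [le_div_iff₀ hL0]
      have := Real.log_le_log (not_le.1 h0) hu
      rw [Real.log_mul hδ.ne' (Real.exp_ne_zero _), Real.log_exp] at this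
      linarith
  refine ⟨δ * Real.exp (-L), χ, by positivity, ?_, ?_, hone, ?_, ?_⟩
  · rw [contDiff_iff_contDiffAt]
    intro u
    rcases lt_or_ge 0 u with hu | hu
    · have h1 : ContDiffAt ℝ ∞
          (fun u => Real.smoothTransition ((Real.log δ - Real.log u) / L)) u :=
        Real.smoothTransition.contDiffAt.comp u
          ((contDiffAt_const.sub (Real.contDiffAt_log.2 hu.ne')).div_const L)
      exact h1.congr_of_eventuallyEq (by
        filter_upwards [lt_mem_nhds hu] with v hv using hpos v hv)
    · refine (contDiffAt_const (c := (1 : ℝ))).congr_of_eventuallyEq ?_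
      filter_upwards [gt_mem_nhds (show u < δ * Real.exp (-L) from hu.trans_lt (by positivity))]
        with v hv using hone v hv.le
  · intro u
    by_cases h0 : u ≤ 0
    · simp [χ, h0]
    · rw [hpos u (not_le.1 h0)]
      exact ⟨Real.smoothTransition.nonneg _, Real.smoothTransition.le_one _⟩
  · intro u hu
    rw [hpos u (hδ.trans_le hu)]
    apply Real.smoothTransition.zero_of_nonpos
    have := Real.log_le_log hδ hu
    exact div_nonpos_of_nonpos_of_nonneg (by linarith) hL0.le
  · intro u v hv huv
    have hu := hv.trans_le huv
    rw [hpos u hu, hpos v hv]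
    have h1 := hlip ((Real.log δ - Real.log u) / L) ((Real.log δ - Real.log v) / L)
    have h2 : Real.log u - Real.log v ≤ (u - v) / v := by
      rw [← Real.log_div hu.ne' hv.ne', sub_div, div_self hv.ne']
      exact Real.log_le_sub_one_of_pos (by positivity)
    have h3 : 0 ≤ Real.log u - Real.log v := sub_nonneg.2 (Real.log_le_log hv huv)
    have h4 : |(Real.log δ - Real.log u) / L - (Real.log δ - Real.log v) / L|
        = (Real.log u - Real.log v) / L := by
      rw [← sub_div, abs_div, abs_of_pos hL0, show Real.log δ - Real.log u - (Real.log δ - Real.log v)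
        = -(Real.log u - Real.log v) by ring, abs_neg, abs_of_nonneg h3]
    rw [h4] at h1
    have h5 : K * ((Real.log u - Real.log v) / L) = η * (Real.log u - Real.log v) := by
      rw [hL]; field_simp
    rw [h5] at h1
    calc _ ≤ η * (Real.log u - Real.log v) * v := by gcongr
      _ ≤ η * ((u - v) / v) * v := by gcongr
      _ = η * (u - v) := by field_simp

/-! ### Straightening a diffeomorphism near the sphere: derivative estimates. -/

section UnitBall

variable {E : Type*} [NormedAddCommGroup E] [InnerProductSpace ℝ E]

open Metric

/-- Differentiate `f` along the great circle through `x` with velocity parallel to `v`, on which `f`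
vanishes. -/
theorem fderivWithin_closedBall_apply_eq_zero {f : E → E} {x v : E} (hx : x ∈ sphere (0 : E) 1)
    (hf : DifferentiableWithinAt ℝ f (closedBall 0 1) x) (hf0 : ∀ z ∈ sphere (0 : E) 1, f z = 0)
    (hv : inner ℝ x v = 0) : fderivWithin ℝ f (closedBall 0 1) x v = 0 := by
  rcases eq_or_ne v 0 with rfl | hv0
  · exact map_zero _
  set w := ‖v‖⁻¹ • v with hw
  have hvn : ‖v‖ ≠ 0 := norm_ne_zero_iff.2 hv0
  have hwn : ‖w‖ = 1 := by rw [hw, norm_smul, norm_inv, norm_norm, inv_mul_cancel₀ hvn]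
  have hxn : ‖x‖ = 1 := by simpa using hx
  have hxw : inner ℝ x w = 0 := by rw [hw, inner_smul_right, hv, mul_zero]
  suffices h : fderivWithin ℝ f (closedBall 0 1) x w = 0 by
    rw [hw, map_smul] at h
    exact (smul_eq_zero.1 h).resolve_left (inv_ne_zero hvn)
  set γ : ℝ → E := fun θ => Real.cos θ • x + Real.sin θ • w with hγ
  have hγs : ∀ θ, γ θ ∈ sphere (0 : E) 1 := by
    intro θ
    have : ‖γ θ‖ ^ 2 = 1 := by
      rw [hγ, norm_add_sq_real, norm_smul, norm_smul, inner_smul_left, inner_smul_right, hxw, hxn,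
        hwn]
      simp
    rw [mem_sphere_zero_iff_norm]
    exact (pow_eq_one_iff_of_nonneg (norm_nonneg _) two_ne_zero).1 this
  have hγd : HasDerivAt γ w 0 := by
    have := ((Real.hasDerivAt_cos 0).smul_const x).add ((Real.hasDerivAt_sin 0).smul_const w)
    simp only [Real.sin_zero, neg_zero, zero_smul, Real.cos_zero, one_smul, zero_add] at this
    exact this
  have hγ0 : γ 0 = x := by simp [hγ]
  have hd : HasFDerivWithinAt f (fderivWithin ℝ f (closedBall 0 1) x) (closedBall 0 1) (γ 0) := by
    rw [hγ0]; exact hf.hasFDerivWithinAt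
  have h1 := hd.comp_hasDerivAt (0 : ℝ) hγd
    (Eventually.of_forall fun θ => sphere_subset_closedBall (hγs θ))
  have h2 : f ∘ γ = fun _ => 0 := funext fun θ => hf0 _ (hγs θ)
  rw [h2] at h1
  exact h1.unique (hasDerivAt_const _ _)

/-- If `z ↦ z + f z` is a self-map of the closed unit ball fixing the sphere pointwise, with
injective derivative, then that derivative points strictly inward. -/
theorem one_add_inner_fderivWithin_pos {f : E → E} {x : E} (hx : x ∈ sphere (0 : E) 1)
    (hf : DifferentiableWithinAt ℝ f (closedBall 0 1) x) (hf0 : ∀ z ∈ sphere (0 : E) 1, f z = 0)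
    (hm : ∀ z ∈ closedBall (0 : E) 1, z + f z ∈ closedBall (0 : E) 1)
    (hinj : ∀ v, v + fderivWithin ℝ f (closedBall 0 1) x v = 0 → v = 0) :
    0 < 1 + inner ℝ x (fderivWithin ℝ f (closedBall 0 1) x x) := by
  set A := fderivWithin ℝ f (closedBall 0 1) x with hA
  have hxn : ‖x‖ = 1 := by simpa using hx
  have hxx : inner ℝ x x = (1 : ℝ) := by rw [real_inner_self_eq_norm_sq, hxn, one_pow]
  have hxD : x ∈ closedBall (0 : E) 1 := sphere_subset_closedBall hx
  -- The height in direction `x` of the image is maximal at `x`, so its derivative in the inward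
  -- direction `-x` is nonpositive. This gives the weak inequality.
  have hmax : IsLocalMaxOn (fun z => inner ℝ x (z + f z)) (closedBall 0 1) x := by
    filter_upwards [self_mem_nhdsWithin] with z hz
    rw [hf0 x hx, add_zero, hxx]
    have h1 := real_inner_le_norm x (z + f z)
    have h2 : ‖z + f z‖ ≤ 1 := by simpa using hm z hz
    rw [hxn, one_mul] at h1
    exact h1.trans h2
  have hd : HasFDerivWithinAt (fun z => inner ℝ x (z + f z))
      ((innerSL ℝ x).comp (ContinuousLinearMap.id ℝ E + A)) (closedBall 0 1) x :=
    (innerSL ℝ x).hasFDerivAt.comp_hasFDerivWithinAt x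
      ((hasFDerivWithinAt_id _ _).add hf.hasFDerivWithinAt)
  have hcone : (0 : E) - x ∈ posTangentConeAt (closedBall (0 : E) 1) x :=
    sub_mem_posTangentConeAt_of_segment_subset
      ((convex_closedBall (0 : E) 1).segment_subset hxD (mem_closedBall_self zero_le_one))
  have hle := hmax.hasFDerivWithinAt_nonpos hd hcone
  simp [hxn] at hle
  have hge : 0 ≤ 1 + inner ℝ x (A x) := by
    linarith
  refine lt_of_le_of_ne hge fun h0 => ?_
  -- In the equality case `x + A x` is tangent, hence killed by `A`; then `id + A` kills `A x`, and
  -- injectivity forces `A x = 0`, which contradicts equality.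
  have h1 : inner ℝ x (x + A x) = 0 := by rw [inner_add_right, hxx]; exact h0.symm
  have h2 : A (x + A x) = 0 := fderivWithin_closedBall_apply_eq_zero hx hf hf0 h1
  have h3 : A x = 0 := by
    apply hinj
    have h4 : A (A x) = -A x := by rw [map_add] at h2; exact (neg_eq_of_add_eq_zero_right h2).symm
    rw [h4, add_neg_cancel]
  rw [h3, inner_zero_right] at h0
  norm_num at h0

/-- The derivative sees only the normal component `a` of `v`. The normal component of the sum is `a`
times a convex combination of `1` and a positive number, so if the sum vanishes then `a = 0`, and
the sum is `v` itself. -/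
theorem add_smul_fderivWithin_ne_zero {f : E → E} {x v : E} {m : ℝ} (hx : x ∈ sphere (0 : E) 1)
    (hf : DifferentiableWithinAt ℝ f (closedBall 0 1) x) (hf0 : ∀ z ∈ sphere (0 : E) 1, f z = 0)
    (hpos : 0 < 1 + inner ℝ x (fderivWithin ℝ f (closedBall 0 1) x x)) (hm : m ∈ Icc (0 : ℝ) 1)
    (hv : v ≠ 0) : v + m • fderivWithin ℝ f (closedBall 0 1) x v ≠ 0 := by
  set A := fderivWithin ℝ f (closedBall 0 1) x with hA
  have hxn : ‖x‖ = 1 := by simpa using hx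
  have hxx : inner ℝ x x = (1 : ℝ) := by rw [real_inner_self_eq_norm_sq, hxn, one_pow]
  set a : ℝ := inner ℝ x v with ha
  have h1 : A (v - a • x) = 0 := by
    apply fderivWithin_closedBall_apply_eq_zero hx hf hf0
    rw [inner_sub_right, inner_smul_right, hxx, ← ha, mul_one, sub_self]
  have h2 : A v = a • A x := by rwa [map_sub, map_smul, sub_eq_zero] at h1
  intro h
  have h3 : a * ((1 - m) + m * (1 + inner ℝ x (A x))) = 0 := by
    have := congrArg (inner ℝ x) h
    rw [h2, inner_add_right, inner_smul_right, inner_smul_right, inner_zero_right, ← ha] at this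
    linarith
  have h4 : 0 < (1 - m) + m * (1 + inner ℝ x (A x)) := by
    rcases hm.2.lt_or_eq with hlt | heq
    · have := mul_nonneg hm.1 hpos.le
      linarith
    · rw [heq]; linarith
  have h5 : a = 0 := (mul_eq_zero.1 h3).resolve_right h4.ne'
  rw [h2, h5, zero_smul, smul_zero, add_zero] at h
  exact hv h

/-- Lets `1 - ‖z‖ ^ 2`, which is smooth also at the origin, replace the distance to the sphere. -/
theorem exists_mem_sphere_norm_sub_le [Nontrivial E] {z : E} (hz : z ∈ closedBall (0 : E) 1) :
    ∃ x ∈ sphere (0 : E) 1, ‖z - x‖ ≤ 1 - ‖z‖ ^ 2 := by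
  have hz1 : ‖z‖ ≤ 1 := by simpa using hz
  rcases eq_or_ne z 0 with rfl | h0
  · obtain ⟨x, hx⟩ := exists_norm_eq E zero_le_one
    exact ⟨x, by simpa using hx, by simp [hx]⟩
  · have hn : 0 < ‖z‖ := norm_pos_iff.2 h0
    refine ⟨‖z‖⁻¹ • z, by simp [norm_smul, hn.ne'], ?_⟩
    have : z - ‖z‖⁻¹ • z = (1 - ‖z‖⁻¹) • z := by rw [sub_smul, one_smul]
    rw [this, norm_smul, Real.norm_eq_abs, abs_of_nonpos (by
      rw [sub_nonpos]; exact (one_le_inv₀ hn).2 hz1)]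
    have : -(1 - ‖z‖⁻¹) * ‖z‖ = 1 - ‖z‖ := by field_simp; ring
    rw [this]
    nlinarith

variable [FiniteDimensional ℝ E]

theorem exists_le_norm_add_smul_fderivWithin {f : E → E}
    (hf : ContDiffOn ℝ 1 f (closedBall 0 1)) (hf0 : ∀ z ∈ sphere (0 : E) 1, f z = 0)
    (hpos : ∀ x ∈ sphere (0 : E) 1, 0 < 1 + inner ℝ x (fderivWithin ℝ f (closedBall 0 1) x x)) :
    ∃ μ : ℝ, 0 < μ ∧ ∀ x ∈ sphere (0 : E) 1, ∀ m ∈ Icc (0 : ℝ) 1, ∀ v : E,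
      μ * ‖v‖ ≤ ‖v + m • fderivWithin ℝ f (closedBall 0 1) x v‖ := by
  have hud : UniqueDiffOn ℝ (closedBall (0 : E) 1) := uniqueDiffOn_convex (convex_closedBall _ _)
    ⟨0, ball_subset_interior_closedBall (mem_ball_self one_pos)⟩
  have hcont := (hf.continuousOn_fderivWithin hud le_rfl).mono sphere_subset_closedBall
  have hK : IsCompact (sphere (0 : E) 1 ×ˢ Icc (0 : ℝ) 1 ×ˢ sphere (0 : E) 1) :=
    (isCompact_sphere _ _).prod (isCompact_Icc.prod (isCompact_sphere _ _))
  have hc : ContinuousOn (fun p : E × ℝ × E =>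
      ‖p.2.2 + p.2.1 • fderivWithin ℝ f (closedBall 0 1) p.1 p.2.2‖)
      (sphere (0 : E) 1 ×ˢ Icc (0 : ℝ) 1 ×ˢ sphere (0 : E) 1) := by
    have h1 : ContinuousOn (fun p : E × ℝ × E => fderivWithin ℝ f (closedBall 0 1) p.1)
        (sphere (0 : E) 1 ×ˢ Icc (0 : ℝ) 1 ×ˢ sphere (0 : E) 1) :=
      hcont.comp continuous_fst.continuousOn fun p hp => hp.1
    exact ((continuous_snd.snd.continuousOn).add ((continuous_snd.fst.continuousOn).smul
      (h1.clm_apply continuous_snd.snd.continuousOn))).norm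
  obtain ⟨μ, hμ, hmin⟩ := hK.exists_forall_le' hc (a := 0) (by
    rintro ⟨x, m, v⟩ ⟨hx, hm, hv⟩
    exact norm_pos_iff.2 (add_smul_fderivWithin_ne_zero hx
      (hf.differentiableOn one_ne_zero x (sphere_subset_closedBall hx)) hf0 (hpos x hx) hm
      (ne_zero_of_mem_unit_sphere ⟨v, hv⟩)))
  refine ⟨μ, hμ, fun x hx m hm v => ?_⟩
  rcases eq_or_ne v 0 with rfl | hv
  · simp
  have hvn : 0 < ‖v‖ := norm_pos_iff.2 hv
  have := hmin (x, m, ‖v‖⁻¹ • v) ⟨hx, hm, by simp [norm_smul, hvn.ne']⟩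
  simp only [map_smul] at this
  rw [smul_comm m, ← smul_add, norm_smul, norm_inv, norm_norm, inv_mul_eq_div,
    le_div_iff₀ hvn] at this
  exact this

/-- The deformation `t ↦ h t`, from `α` to a map which is the identity near the sphere, stays
uniformly antilipschitz when the cutoff is slow enough. -/
theorem exists_cutoff_antilipschitz [Nontrivial E] {α : E → E}
    (hα : IsSmoothDiffeo (closedBall (0 : E) 1) (closedBall (0 : E) 1) α)
    (hb : ∀ z ∈ sphere (0 : E) 1, α z = z) :
    ∃ (ε c : ℝ) (χ : ℝ → ℝ), 0 < ε ∧ 0 < c ∧ ContDiff ℝ ∞ χ ∧ (∀ u, χ u ∈ Icc (0 : ℝ) 1) ∧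
      (∀ u ≤ ε, χ u = 1) ∧
      ∀ t ∈ Icc (0 : ℝ) 1, ∀ p ∈ closedBall (0 : E) 1, ∀ q ∈ closedBall (0 : E) 1,
        c * ‖p - q‖ ≤ ‖(α p + (t * χ (1 - ‖p‖ ^ 2)) • (p - α p)) -
          (α q + (t * χ (1 - ‖q‖ ^ 2)) • (q - α q))‖ := by
  set D := closedBall (0 : E) 1 with hD
  have hDc : Convex ℝ D := convex_closedBall _ _
  have hDi : (interior D).Nonempty :=
    ⟨0, ball_subset_interior_closedBall (mem_ball_self one_pos)⟩
  have hDk : IsCompact D := isCompact_closedBall _ _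
  have hSD : sphere (0 : E) 1 ⊆ D := sphere_subset_closedBall
  have hud : UniqueDiffOn ℝ D := uniqueDiffOn_convex hDc hDi
  obtain ⟨c₀, hc₀, hanti⟩ : ∃ c₀ : ℝ, 0 < c₀ ∧ ∀ p ∈ D, ∀ q ∈ D,
      c₀ * ‖p - q‖ ≤ ‖α p - α q‖ := by
    obtain ⟨g, hg, hgs⟩ := hα.contDiffOn_inv
    obtain ⟨K, hK⟩ := hgs.exists_lipschitzOnWith (by simp) hDc hDk
    refine ⟨((K : ℝ) + 1)⁻¹, by positivity, fun p hp q hq => ?_⟩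
    have h1 := hK.dist_le_mul _ (hα.bijOn.mapsTo hp) _ (hα.bijOn.mapsTo hq)
    rw [hg.1 hp, hg.1 hq, dist_eq_norm, dist_eq_norm] at h1
    rw [inv_mul_eq_div, div_le_iff₀ (by positivity)]
    nlinarith [norm_nonneg (α p - α q)]
  set f : E → E := fun z => α z - z with hf
  have hαf : ∀ z, α z = z + f z := fun z => by simp [hf]
  have hf1 : ContDiffOn ℝ 1 f D :=
    (hα.contDiffOn.of_le (by exact_mod_cast le_top)).sub contDiffOn_id
  have hf0 : ∀ z ∈ sphere (0 : E) 1, f z = 0 := fun z hz => by simp [hf, hb z hz]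
  obtain ⟨L, hL, hlip⟩ : ∃ L : ℝ, 0 < L ∧ ∀ p ∈ D, ∀ q ∈ D, ‖f p - f q‖ ≤ L * ‖p - q‖ := by
    obtain ⟨K, hK⟩ := hf1.exists_lipschitzOnWith one_ne_zero hDc hDk
    refine ⟨K + 1, by positivity, fun p hp q hq => ?_⟩
    have h1 := hK.dist_le_mul _ hp _ hq
    rw [dist_eq_norm, dist_eq_norm] at h1
    linarith [norm_nonneg (p - q)]
  have hfu : ∀ p ∈ D, ‖f p‖ ≤ L * (1 - ‖p‖ ^ 2) := by
    intro p hp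
    obtain ⟨x, hx, hpx⟩ := exists_mem_sphere_norm_sub_le hp
    have := hlip p hp x (hSD hx)
    rw [hf0 x hx, sub_zero] at this
    exact this.trans (by gcongr)
  have hder : ∀ x ∈ D, HasFDerivWithinAt f (fderivWithin ℝ f D x) D x := fun x hx =>
    (hf1.differentiableOn one_ne_zero x hx).hasFDerivWithinAt
  have hpos : ∀ x ∈ sphere (0 : E) 1, 0 < 1 + inner ℝ x (fderivWithin ℝ f D x x) := by
    intro x hx
    refine one_add_inner_fderivWithin_pos hx (hf1.differentiableOn one_ne_zero x (hSD hx)) hf0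
      (fun z hz => by rw [← hαf]; exact hα.bijOn.mapsTo hz) fun v hv => ?_
    have h1 : HasFDerivWithinAt α (ContinuousLinearMap.id ℝ E + fderivWithin ℝ f D x) D x :=
      ((hasFDerivWithinAt_id _ _).add (hder x (hSD hx))).congr (fun z _ => hαf z) (hαf x)
    have h2 := le_norm_fderivWithin_of_antilipschitz hDc hDi
      (hα.contDiffOn.of_le (by exact_mod_cast le_top)) hanti (hSD hx) v
    rw [h1.fderivWithin (hud x (hSD hx))] at h2
    simp only [add_apply, ContinuousLinearMap.id_apply] at h2
    rw [hv, norm_zero] at h2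
    exact norm_le_zero_iff.1 (nonpos_of_mul_nonpos_right h2 hc₀)
  obtain ⟨μ, hμ, hμb⟩ := exists_le_norm_add_smul_fderivWithin hf1 hf0 hpos
  obtain ⟨ρ, hρ, hρb⟩ := Metric.uniformContinuousOn_iff.1
    (hDk.uniformContinuousOn_of_continuous (hf1.continuousOn_fderivWithin hud le_rfl)) (μ / 4)
    (by positivity)
  -- The first bound makes `h = α` wherever `u ≥ ρ / 2`. The second keeps `h` within `c₀ * ρ / 8` of
  -- `α`, which pairs at distance at least `ρ / 2` can absorb.
  set δ := min (ρ / 2) (c₀ * ρ / (8 * L)) with hδ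
  have hδ0 : 0 < δ := by positivity
  have hδ1 : δ ≤ ρ / 2 := min_le_left _ _
  have hδ2 : L * δ ≤ c₀ * ρ / 8 := by
    have : δ ≤ c₀ * ρ / (8 * L) := min_le_right _ _
    rw [le_div_iff₀ (by positivity)] at this
    linarith
  obtain ⟨ε, χ, hε, hχs, hχI, hχ1, hχ0, hχl⟩ :=
    exists_slow_cutoff (δ := δ) (η := μ / (8 * L)) hδ0 (by positivity)
  refine ⟨ε, min (μ / 2) (c₀ / 2), χ, hε, by positivity, hχs, hχI, hχ1, ?_⟩
  intro t ht
  set h : E → E := fun p => α p + (t * χ (1 - ‖p‖ ^ 2)) • (p - α p) with hh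
  set u : E → ℝ := fun p => 1 - ‖p‖ ^ 2 with hu
  set m : E → ℝ := fun p => 1 - t * χ (u p) with hm
  have hmI : ∀ p, m p ∈ Icc (0 : ℝ) 1 := by
    intro p
    have h1 := mul_nonneg ht.1 (hχI (u p)).1
    have h2 := mul_le_one₀ ht.2 (hχI (u p)).1 (hχI (u p)).2
    exact ⟨by simp only [hm]; linarith, by simp only [hm]; linarith⟩
  have hhm : ∀ p, h p = p + m p • f p := by
    intro p
    simp only [hh, hm, hf, hu]
    module
  have hu0 : ∀ p ∈ D, 0 ≤ u p := by
    intro p hp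
    have : ‖p‖ ≤ 1 := by simpa [hD] using hp
    simp only [hu]
    nlinarith [norm_nonneg p]
  have hulip : ∀ p ∈ D, ∀ q ∈ D, u p - u q ≤ 2 * ‖p - q‖ := by
    intro p hp q hq
    have h1 : ‖p‖ ≤ 1 := by simpa [hD] using hp
    have h2 : ‖q‖ ≤ 1 := by simpa [hD] using hq
    have h3 : ‖q‖ - ‖p‖ ≤ ‖p - q‖ := by rw [norm_sub_rev]; exact norm_sub_norm_le q p
    simp only [hu]
    nlinarith [norm_nonneg p, norm_nonneg q, norm_nonneg (p - q)]
  -- Linearization at `x`: of the lower bound `μ`, one quarter is lost to the variation of the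
  -- derivative of `f` and one quarter to the variation of the cutoff. The latter is multiplied by
  -- `f q`, of size at most `L * u q`, hence the ordering `u q ≤ u p` that suits the slow cutoff.
  have hnear : ∀ x ∈ sphere (0 : E) 1, ∀ p ∈ D, ∀ q ∈ D, ‖p - x‖ < ρ → ‖q - x‖ < ρ →
      u q ≤ u p → μ / 2 * ‖p - q‖ ≤ ‖h p - h q‖ := by
    intro x hx p hp q hq hpx hqx huqp
    set A := fderivWithin ℝ f D x with hA
    have e1 : ‖f p - f q - A (p - q)‖ ≤ μ / 4 * ‖p - q‖ := by
      refine Convex.norm_image_sub_le_of_norm_hasFDerivWithin_le' (s := D ∩ ball x ρ)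
        (f' := fderivWithin ℝ f D)
        (fun z hz => (hder z hz.1).mono inter_subset_left) (fun z hz => ?_)
        (hDc.inter (convex_ball _ _)) ⟨hq, by rwa [mem_ball, dist_eq_norm]⟩
        ⟨hp, by rwa [mem_ball, dist_eq_norm]⟩
      have := hρb z hz.1 x (hSD hx) hz.2
      rw [dist_eq_norm] at this
      exact this.le
    have e2 : ‖(m p - m q) • f q‖ ≤ μ / 4 * ‖p - q‖ := by
      rw [norm_smul, Real.norm_eq_abs]
      have h1 : |m p - m q| ≤ |χ (u p) - χ (u q)| := by
        have : m p - m q = t * (χ (u q) - χ (u p)) := by simp only [hm]; ring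
        rw [this, abs_mul, abs_of_nonneg ht.1, abs_sub_comm]
        exact mul_le_of_le_one_left (abs_nonneg _) ht.2
      have h2 : |χ (u p) - χ (u q)| * u q ≤ μ / (8 * L) * (2 * ‖p - q‖) := by
        rcases (hu0 q hq).lt_or_eq with h0 | h0
        · exact (hχl _ _ h0 huqp).trans (by gcongr; exact hulip p hp q hq)
        · rw [← h0, mul_zero]; positivity
      calc |m p - m q| * ‖f q‖ ≤ |χ (u p) - χ (u q)| * (L * u q) := by
            gcongr; exact hfu q hq
        _ = L * (|χ (u p) - χ (u q)| * u q) := by ring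
        _ ≤ L * (μ / (8 * L) * (2 * ‖p - q‖)) := by gcongr
        _ = μ / 4 * ‖p - q‖ := by field_simp; ring
    have e3 : ‖m p • (f p - f q - A (p - q))‖ ≤ μ / 4 * ‖p - q‖ := by
      rw [norm_smul, Real.norm_eq_abs, abs_of_nonneg (hmI p).1]
      exact (mul_le_of_le_one_left (norm_nonneg _) (hmI p).2).trans e1
    have e4 := hμb x hx (m p) (hmI p) (p - q)
    have e5 : (p - q) + m p • A (p - q) =
        (h p - h q) - m p • (f p - f q - A (p - q)) - (m p - m q) • f q := by
      rw [hhm, hhm]; module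
    rw [e5] at e4
    have e6 := norm_sub_le ((h p - h q) - m p • (f p - f q - A (p - q))) ((m p - m q) • f q)
    have e7 := norm_sub_le (h p - h q) (m p • (f p - f q - A (p - q)))
    linarith
  have hfar : ∀ p ∈ D, ‖h p - α p‖ ≤ L * δ := by
    intro p hp
    have h1 : h p - α p = (-(t * χ (u p))) • f p := by simp only [hh, hf, hu]; module
    rcases le_or_gt δ (u p) with h2 | h2
    · rw [h1, hχ0 _ h2]; simp only [mul_zero, neg_zero, zero_smul, norm_zero]; positivity
    · rw [h1, norm_smul, norm_neg, Real.norm_eq_abs, abs_of_nonneg (mul_nonneg ht.1 (hχI _).1)]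
      have h3 := mul_le_one₀ ht.2 (hχI (u p)).1 (hχI (u p)).2
      calc _ ≤ ‖f p‖ := mul_le_of_le_one_left (norm_nonneg _) h3
        _ ≤ L * u p := hfu p hp
        _ ≤ L * δ := by gcongr
  intro p hp q hq
  change min (μ / 2) (c₀ / 2) * ‖p - q‖ ≤ ‖h p - h q‖
  have hn := norm_nonneg (p - q)
  have hmin1 : min (μ / 2) (c₀ / 2) * ‖p - q‖ ≤ μ / 2 * ‖p - q‖ := by
    gcongr; exact min_le_left _ _
  have hmin2 : min (μ / 2) (c₀ / 2) * ‖p - q‖ ≤ c₀ / 2 * ‖p - q‖ := by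
    gcongr; exact min_le_right _ _
  -- Three cases: distant pairs, where `h` is a small perturbation of `α`; close pairs with a point
  -- near the sphere, where `hnear` applies; close pairs deep inside, where `h = α`.
  rcases le_or_gt (ρ / 2) ‖p - q‖ with hpq | hpq
  · refine hmin2.trans ?_
    have h1 := hanti p hp q hq
    have h2 := hfar p hp
    have h3 := hfar q hq
    have h4 : α p - α q = (h p - h q) - (h p - α p) + (h q - α q) := by abel
    have h5 := norm_add_le ((h p - h q) - (h p - α p)) (h q - α q)
    have h6 := norm_sub_le (h p - h q) (h p - α p)
    rw [h4] at h1
    have h7 : c₀ * (ρ / 2) ≤ c₀ * ‖p - q‖ := by gcongr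
    linarith
  have hnear' : ∀ x ∈ sphere (0 : E) 1, ‖p - x‖ < ρ → ‖q - x‖ < ρ →
      min (μ / 2) (c₀ / 2) * ‖p - q‖ ≤ ‖h p - h q‖ := by
    intro x hx h1 h2
    refine hmin1.trans ?_
    rcases le_total (u q) (u p) with h3 | h3
    · exact hnear x hx p hp q hq h1 h2 h3
    · rw [norm_sub_rev p, norm_sub_rev (h p)]
      exact hnear x hx q hq p hp h2 h1 h3
  rcases lt_or_ge (u p) (ρ / 2) with h1 | h1
  · obtain ⟨x, hx, hpx⟩ := exists_mem_sphere_norm_sub_le hp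
    have h2 := norm_sub_le_norm_sub_add_norm_sub q p x
    rw [norm_sub_rev q p] at h2
    have h3 : ‖p - x‖ < ρ / 2 := hpx.trans_lt h1
    exact hnear' x hx (by linarith) (by linarith)
  rcases lt_or_ge (u q) (ρ / 2) with h2 | h2
  · obtain ⟨x, hx, hqx⟩ := exists_mem_sphere_norm_sub_le hq
    have h3 := norm_sub_le_norm_sub_add_norm_sub p q x
    have h4 : ‖q - x‖ < ρ / 2 := hqx.trans_lt h2
    exact hnear' x hx (by linarith) (by linarith)
  · have hid : ∀ z, ρ / 2 ≤ u z → h z = α z := by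
      intro z hz
      change α z + (t * χ (u z)) • (z - α z) = α z
      rw [hχ0 _ (hδ1.trans hz), mul_zero, zero_smul, add_zero]
    rw [hid p h1, hid q h2]
    exact hmin2.trans (le_trans (by gcongr; linarith) (hanti p hp q hq))

end UnitBall

theorem IsSmoothDiffeo.prodMap_id {E F G : Type*} [NormedAddCommGroup E] [NormedSpace ℝ E]
    [NormedAddCommGroup F] [NormedSpace ℝ F] [NormedAddCommGroup G] [NormedSpace ℝ G]
    {s : Set E} {t : Set F} {f : E → F} (hf : IsSmoothDiffeo s t f) (u : Set G) :
    IsSmoothDiffeo (u ×ˢ s) (u ×ˢ t) (Prod.map id f) := by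
  obtain ⟨g, hg, hgs⟩ := hf.contDiffOn_inv
  refine .of_invOn (g := Prod.map id g) ⟨?_, ?_⟩ ?_ ?_ ?_ ?_
  · exact fun p hp => Prod.ext rfl (hg.1 hp.2)
  · exact fun p hp => Prod.ext rfl (hg.2 hp.2)
  · exact fun p hp => ⟨hp.1, hf.bijOn.mapsTo hp.2⟩
  · exact fun p hp => ⟨hp.1, (hf.bijOn.symm hg.symm).mapsTo hp.2⟩
  · exact contDiffOn_fst.prodMk (hf.contDiffOn.comp contDiffOn_snd fun p hp => hp.2)
  · exact contDiffOn_fst.prodMk (hgs.comp contDiffOn_snd fun p hp => hp.2)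

/-! ### The isotopy from `α` to a map that is the identity near the sphere. -/

section UnitBall

open Metric

variable {E : Type*} [NormedAddCommGroup E] [InnerProductSpace ℝ E]

theorem exists_isotopy_to_eq_id_near_sphere [FiniteDimensional ℝ E] [Nontrivial E] {α : E → E}
    (hα : IsSmoothDiffeo (closedBall (0 : E) 1) (closedBall (0 : E) 1) α)
    (hb : ∀ z ∈ sphere (0 : E) 1, α z = z) :
    ∃ (ε : ℝ) (h : ℝ → E → E), 0 < ε ∧
      IsSmoothDiffeo (Icc (0 : ℝ) 1 ×ˢ closedBall (0 : E) 1) (Icc (0 : ℝ) 1 ×ˢ closedBall (0 : E) 1)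
        (fun p => (p.1, h p.1 p.2)) ∧
      IsSmoothDiffeo (closedBall (0 : E) 1) (closedBall (0 : E) 1) (h 1) ∧
      (∀ z, h 0 z = α z) ∧ (∀ t, ∀ z ∈ sphere (0 : E) 1, h t z = z) ∧
      ∀ z, 1 - ‖z‖ ^ 2 ≤ ε → h 1 z = z := by
  obtain ⟨ε, c, χ, hε, hc, hχs, hχI, hχ1, hanti⟩ := exists_cutoff_antilipschitz hα hb
  set D := closedBall (0 : E) 1 with hD
  have hDc : Convex ℝ D := convex_closedBall _ _
  have h0i : (0 : E) ∈ interior D := ball_subset_interior_closedBall (mem_ball_self one_pos)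
  let h : ℝ → E → E := fun t z => α z + (t * χ (1 - ‖z‖ ^ 2)) • (z - α z)
  have hsmooth : ContDiffOn ℝ ∞ (fun p : ℝ × E => h p.1 p.2) (Icc (0 : ℝ) 1 ×ˢ D) := by
    have h1 : ContDiffOn ℝ ∞ (fun p : ℝ × E => α p.2) (Icc (0 : ℝ) 1 ×ˢ D) :=
      hα.contDiffOn.comp contDiffOn_snd fun p hp => hp.2
    have h2 : ContDiff ℝ ∞ (fun p : ℝ × E => p.1 * χ (1 - ‖p.2‖ ^ 2)) :=
      contDiff_fst.mul (hχs.comp (contDiff_const.sub (contDiff_snd.norm_sq ℝ)))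
    exact h1.add (h2.contDiffOn.smul (contDiffOn_snd.sub h1))
  have hslice : ∀ t ∈ Icc (0 : ℝ) 1, ContDiffOn ℝ ∞ (h t) D := fun t ht =>
    hsmooth.comp (contDiffOn_const.prodMk contDiffOn_id) fun z hz => ⟨ht, hz⟩
  have hcoef : ∀ t ∈ Icc (0 : ℝ) 1, ∀ z : E, t * χ (1 - ‖z‖ ^ 2) ∈ Icc (0 : ℝ) 1 := fun t ht z =>
    ⟨mul_nonneg ht.1 (hχI _).1, mul_le_one₀ ht.2 (hχI _).1 (hχI _).2⟩
  have hconv : ∀ t ∈ Icc (0 : ℝ) 1, ∀ C : Set E, Convex ℝ C → ∀ z ∈ C, α z ∈ C → h t z ∈ C :=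
    fun t ht C hC z hz hαz => hC.add_smul_sub_mem hαz hz (hcoef t ht z)
  have hsph : ∀ t, ∀ z ∈ sphere (0 : E) 1, h t z = z := by
    intro t z hz
    simp [h, hb z hz]
  have hmD : ∀ t ∈ Icc (0 : ℝ) 1, MapsTo (h t) D D := fun t ht z hz =>
    hconv t ht D hDc z hz (hα.bijOn.mapsTo hz)
  have hαball : ∀ z ∈ ball (0 : E) 1, α z ∈ ball (0 : E) 1 := by
    intro z hz
    have hzD := ball_subset_closedBall hz
    rcases (mem_closedBall.1 (hα.bijOn.mapsTo hzD)).lt_or_eq with hlt | heq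
    · exact hlt
    -- If `α z` is on the sphere then `α` fixes it, so `α (α z) = α z`.
    · have h1 : α z = z := hα.bijOn.injOn (hα.bijOn.mapsTo hzD) hzD (hb _ heq)
      rwa [h1]
  have hsurj : ∀ t ∈ Icc (0 : ℝ) 1, SurjOn (h t) D D := fun t ht =>
    surjOn_closedBall_of_antilipschitz ((hslice t ht).of_le (by exact_mod_cast le_top)) hc one_pos
      (hanti t ht) (fun z hz => hconv t ht _ (convex_ball _ _) z hz (hαball z hz)) (hsph t)
  have htime : ∀ s ∈ Icc (0 : ℝ) 1, ∀ t ∈ Icc (0 : ℝ) 1, ∀ z ∈ D,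
      ‖h s z - h t z‖ ≤ 2 * |s - t| := by
    intro s _ t _ z hz
    have h1 : h s z - h t z = ((s - t) * χ (1 - ‖z‖ ^ 2)) • (z - α z) := by
      simp only [h]; module
    have h2 : ‖z - α z‖ ≤ 2 := by
      have h3 : ‖z‖ ≤ 1 := by simpa [hD] using hz
      have h4 : ‖α z‖ ≤ 1 := by simpa [hD] using hα.bijOn.mapsTo hz
      linarith [norm_sub_le z (α z)]
    rw [h1, norm_smul, norm_mul, Real.norm_eq_abs, Real.norm_eq_abs, abs_of_nonneg (hχI _).1]
    have h5 : |s - t| * χ (1 - ‖z‖ ^ 2) ≤ |s - t| :=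
      mul_le_of_le_one_right (abs_nonneg _) (hχI _).2
    calc _ ≤ |s - t| * 2 := by gcongr
      _ = _ := mul_comm _ _
  refine ⟨ε, h, hε, ?_, ?_, fun z => by simp [h], hsph, fun z hz => by simp [h, hχ1 _ hz]⟩
  -- With `M` the sup-norm distance of the two image points, moving both to the same time costs at
  -- most `2 * |s - t| ≤ 2 * M`, so `c * ‖p - q‖ ≤ 3 * M`.
  · refine isSmoothDiffeo_of_antilipschitz (c := min 1 (c / 3)) ((convex_Icc 0 1).prod hDc) ?_
      (contDiffOn_fst.prodMk hsmooth) (by positivity) ?_ ?_ ?_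
    · rw [interior_prod_eq, interior_Icc]
      exact ⟨(1 / 2, 0), ⟨by norm_num, by norm_num⟩, h0i⟩
    · rintro ⟨s, p⟩ ⟨hs, hp⟩ ⟨t, q⟩ ⟨ht, hq⟩
      simp only [Prod.mk_sub_mk, Prod.norm_mk, Real.norm_eq_abs]
      set M := max |s - t| ‖h s p - h t q‖
      have h1 : |s - t| ≤ M := le_max_left _ _
      have h2 : ‖h s p - h t q‖ ≤ M := le_max_right _ _
      have h3 : c * ‖p - q‖ ≤ ‖h s p - h s q‖ := hanti s hs p hp q hq
      have h4 := htime s hs t ht q hq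
      have h5 := norm_sub_le (h s p - h t q) (h s q - h t q)
      rw [sub_sub_sub_cancel_right] at h5
      rw [mul_max_of_nonneg _ _ (by positivity)]
      refine max_le ?_ ?_
      · exact (mul_le_of_le_one_left (abs_nonneg _) (min_le_left _ _)).trans h1
      · calc min 1 (c / 3) * ‖p - q‖ ≤ c / 3 * ‖p - q‖ := by gcongr; exact min_le_right _ _
          _ ≤ M := by linarith
    · exact fun p hp => ⟨hp.1, hmD p.1 hp.1 hp.2⟩
    · rintro ⟨t, z⟩ ⟨ht, hz⟩
      obtain ⟨w, hw, rfl⟩ := hsurj t ht hz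
      exact ⟨(t, w), ⟨ht, hw⟩, rfl⟩
  · have h1 : (1 : ℝ) ∈ Icc (0 : ℝ) 1 := ⟨zero_le_one, le_rfl⟩
    exact isSmoothDiffeo_of_antilipschitz hDc ⟨0, h0i⟩ (hslice 1 h1) hc (hanti 1 h1) (hmD 1 h1)
      (hsurj 1 h1)

/-- Extension by the identity of a map of the closed unit ball which is the identity near the
sphere. -/
theorem contDiff_piecewise_closedBall {f : E → E} {ε : ℝ} (hε : 0 < ε)
    [∀ z, Decidable (z ∈ closedBall (0 : E) 1)]
    (hf : ContDiffOn ℝ ∞ f (closedBall (0 : E) 1))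
    (hid : ∀ z ∈ closedBall (0 : E) 1, 1 - ‖z‖ ^ 2 ≤ ε → f z = z) :
    ContDiff ℝ ∞ ((closedBall (0 : E) 1).piecewise f id) := by
  rw [contDiff_iff_contDiffAt]
  intro z
  rcases lt_or_ge ‖z‖ 1 with hz | hz
  · have hn : closedBall (0 : E) 1 ∈ 𝓝 z := by
      refine mem_of_superset (isOpen_ball.mem_nhds ?_) ball_subset_closedBall
      simpa using hz
    refine (hf.contDiffAt hn).congr_of_eventuallyEq ?_
    filter_upwards [hn] with w hw using piecewise_eq_of_mem _ _ _ hw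
  · refine contDiffAt_id.congr_of_eventuallyEq ?_
    have hc : Continuous fun w : E => 1 - ‖w‖ ^ 2 := by fun_prop
    have hlt : 1 - ‖z‖ ^ 2 < ε := by nlinarith
    filter_upwards [hc.continuousAt.eventually_lt_const hlt] with w hw
    by_cases hwD : w ∈ closedBall (0 : E) 1
    · rw [piecewise_eq_of_mem _ _ _ hwD]; exact hid w hwD hw.le
    · exact piecewise_eq_of_notMem _ _ _ hwD

/-- A global map is needed because `shrink` evaluates its argument outside the unit ball. -/
theorem IsSmoothDiffeo.exists_extension {f : E → E} {ε : ℝ} (hε : 0 < ε)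
    (hf : IsSmoothDiffeo (closedBall (0 : E) 1) (closedBall (0 : E) 1) f)
    (hid : ∀ z ∈ closedBall (0 : E) 1, 1 - ‖z‖ ^ 2 ≤ ε → f z = z) :
    ∃ e : E ≃ E, ContDiff ℝ ∞ e ∧ ContDiff ℝ ∞ e.symm ∧ (∀ z ∈ closedBall (0 : E) 1, e z = f z) ∧
      ∀ z, 1 ≤ ‖z‖ → e z = z := by
  classical
  obtain ⟨g, hg, hgs⟩ := hf.contDiffOn_inv
  set D := closedBall (0 : E) 1
  have hfm := hf.bijOn.mapsTo
  have hgm : MapsTo g D D := (hf.bijOn.symm hg.symm).mapsTo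
  have hgid : ∀ z ∈ D, 1 - ‖z‖ ^ 2 ≤ ε → g z = z := by
    intro z hz hzε
    conv_lhs => rw [← hid z hz hzε]
    exact hg.1 hz
  have hinv : ∀ {a b : E → E}, MapsTo a D D → LeftInvOn b a D →
      Function.LeftInverse (D.piecewise b id) (D.piecewise a id) := by
    intro a b ha hab z
    by_cases hz : z ∈ D
    · rw [piecewise_eq_of_mem _ _ _ hz, piecewise_eq_of_mem _ _ _ (ha hz), hab hz]
    · rw [piecewise_eq_of_notMem _ a _ hz, id, piecewise_eq_of_notMem _ _ _ hz, id]
  refine ⟨⟨D.piecewise f id, D.piecewise g id, hinv hfm hg.1, hinv hgm hg.2⟩,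
    contDiff_piecewise_closedBall hε hf.contDiffOn hid,
    contDiff_piecewise_closedBall hε hgs hgid,
    fun z hz => piecewise_eq_of_mem _ _ _ hz, fun z hz => ?_⟩
  change D.piecewise f id z = z
  by_cases hzD : z ∈ D
  · rw [piecewise_eq_of_mem _ _ _ hzD]
    exact hid z hzD (by nlinarith)
  · exact piecewise_eq_of_notMem _ _ _ hzD

/-! ### Shrinking the support into a small ball. -/

/-- The conjugate of `f` by the affine map `z ↦ t • p + (1 - t * (1 - r)) • z`, which for `t = 1`
sends the unit ball to the ball of centre `p` and radius `r`. -/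
noncomputable def shrink (f : E → E) (p : E) (r t : ℝ) (z : E) : E :=
  t • p + (1 - t * (1 - r)) • f ((1 - t * (1 - r))⁻¹ • (z - t • p))

section Shrink

variable {p : E} {r t : ℝ}

theorem shrink_scale_pos (hr : 0 < r) (ht : t ∈ Icc (0 : ℝ) 1) : 0 < 1 - t * (1 - r) := by
  have h1 := mul_le_mul_of_nonneg_right ht.2 hr.le
  rcases ht.1.lt_or_eq with h | h
  · nlinarith [mul_pos h hr, ht.2]
  · rw [← h]; norm_num

theorem shrink_zero (f : E → E) (z : E) : shrink f p r 0 z = f z := by simp [shrink]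

theorem shrink_shrink {f g : E → E} (hgf : Function.LeftInverse g f) (hr : 0 < r)
    (ht : t ∈ Icc (0 : ℝ) 1) (z : E) : shrink g p r t (shrink f p r t z) = z := by
  have hc := (shrink_scale_pos hr ht).ne'
  rw [shrink, shrink, add_sub_cancel_left, inv_smul_smul₀ hc, hgf, smul_inv_smul₀ hc,
    add_sub_cancel]

theorem shrink_eq_self {f : E → E} (hf : ∀ z, 1 ≤ ‖z‖ → f z = z) (hr : 0 < r)
    (ht : t ∈ Icc (0 : ℝ) 1) {z : E} (hz : 1 - t * (1 - r) ≤ ‖z - t • p‖) :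
    shrink f p r t z = z := by
  have hc := shrink_scale_pos hr ht
  have h1 : 1 ≤ ‖(1 - t * (1 - r))⁻¹ • (z - t • p)‖ := by
    rw [norm_smul, norm_inv, Real.norm_eq_abs, abs_of_pos hc, inv_mul_eq_div, le_div_iff₀ hc,
      one_mul]
    exact hz
  rw [shrink, hf _ h1, smul_inv_smul₀ hc.ne', add_sub_cancel]

/-- Since `‖p‖ + r ≤ 1`, the ball of centre `t • p` and radius `1 - t * (1 - r)` stays inside the
unit ball. -/
theorem shrink_eq_self_of_one_le {f : E → E} (hf : ∀ z, 1 ≤ ‖z‖ → f z = z) (hr : 0 < r)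
    (hpr : ‖p‖ + r ≤ 1) (ht : t ∈ Icc (0 : ℝ) 1) {z : E} (hz : 1 ≤ ‖z‖) :
    shrink f p r t z = z := by
  refine shrink_eq_self hf hr ht ?_
  have h1 := norm_sub_norm_le z (t • p)
  rw [norm_smul, Real.norm_eq_abs, abs_of_nonneg ht.1] at h1
  have h2 := mul_le_mul_of_nonneg_left hpr ht.1
  linarith

/-- An image point outside the ball would be fixed by the inverse map, hence equal to `z`. -/
theorem shrink_mem_closedBall (e : E ≃ E) (he : ∀ z, 1 ≤ ‖z‖ → e z = z) (hr : 0 < r)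
    (hpr : ‖p‖ + r ≤ 1) (ht : t ∈ Icc (0 : ℝ) 1) {z : E} (hz : z ∈ closedBall (0 : E) 1) :
    shrink e p r t z ∈ closedBall (0 : E) 1 := by
  by_contra h
  have h1 : 1 < ‖shrink e p r t z‖ := by simpa using h
  have hes : ∀ z, 1 ≤ ‖z‖ → e.symm z = z := fun w hw => by
    rw [Equiv.symm_apply_eq, he w hw]
  have h2 := shrink_eq_self_of_one_le hes hr hpr ht h1.le
  rw [shrink_shrink (f := e) (g := e.symm) e.left_inv hr ht] at h2
  rw [← h2] at h
  exact h hz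

theorem contDiffOn_shrink {f : E → E} (hf : ContDiff ℝ ∞ f) (hr : 0 < r) (s : Set E) :
    ContDiffOn ℝ ∞ (fun q : ℝ × E => shrink f p r q.1 q.2) (Icc (0 : ℝ) 1 ×ˢ s) := by
  have h1 : ContDiff ℝ ∞ (fun q : ℝ × E => 1 - q.1 * (1 - r)) := by fun_prop
  have h2 : ContDiff ℝ ∞ (fun q : ℝ × E => q.1 • p) := by fun_prop
  have h3 : ContDiffOn ℝ ∞ (fun q : ℝ × E => (1 - q.1 * (1 - r))⁻¹) (Icc (0 : ℝ) 1 ×ˢ s) :=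
    h1.contDiffOn.inv fun q hq => (shrink_scale_pos hr hq.1).ne'
  exact h2.contDiffOn.add (h1.contDiffOn.smul
    (hf.comp_contDiffOn (h3.smul (contDiffOn_snd.sub h2.contDiffOn))))

theorem isSmoothDiffeo_shrink (e : E ≃ E) (he : ∀ z, 1 ≤ ‖z‖ → e z = z) (hes : ContDiff ℝ ∞ e)
    (hes' : ContDiff ℝ ∞ e.symm) (hr : 0 < r) (hpr : ‖p‖ + r ≤ 1) :
    IsSmoothDiffeo (Icc (0 : ℝ) 1 ×ˢ closedBall (0 : E) 1) (Icc (0 : ℝ) 1 ×ˢ closedBall (0 : E) 1)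
      (fun q => (q.1, shrink e p r q.1 q.2)) := by
  have he' : ∀ z, 1 ≤ ‖z‖ → e.symm z = z := fun w hw => by rw [Equiv.symm_apply_eq, he w hw]
  refine .of_invOn (g := fun q => (q.1, shrink e.symm p r q.1 q.2)) ⟨?_, ?_⟩ ?_ ?_ ?_ ?_
  · exact fun q hq => Prod.ext rfl (shrink_shrink e.left_inv hr hq.1 _)
  · exact fun q hq => Prod.ext rfl (shrink_shrink e.right_inv hr hq.1 _)
  · exact fun q hq => ⟨hq.1, shrink_mem_closedBall e he hr hpr hq.1 hq.2⟩
  · exact fun q hq => ⟨hq.1, shrink_mem_closedBall e.symm he' hr hpr hq.1 hq.2⟩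
  · exact contDiffOn_fst.prodMk (contDiffOn_shrink hes hr _)
  · exact contDiffOn_fst.prodMk (contDiffOn_shrink hes' hr _)

end Shrink

end UnitBall

/-- The slices of a level-preserving diffeomorphism are diffeomorphisms. -/
theorem IsSmoothDiffeo.slice {E : Type*} [NormedAddCommGroup E] [NormedSpace ℝ E] {u : Set ℝ}
    {s : Set E} {g : ℝ → E → E} (hg : IsSmoothDiffeo (u ×ˢ s) (u ×ˢ s) (fun q => (q.1, g q.1 q.2)))
    {t : ℝ} (ht : t ∈ u) : IsSmoothDiffeo s s (g t) := by
  obtain ⟨k, hk, hks⟩ := hg.contDiffOn_inv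
  have hkm : MapsTo k (u ×ˢ s) (u ×ˢ s) := (hg.bijOn.symm hk.symm).mapsTo
  have hk1 : ∀ z ∈ s, (k (t, z)).1 = t := fun z hz => congrArg Prod.fst (hk.2 ⟨ht, hz⟩)
  refine .of_invOn (g := fun z => (k (t, z)).2) ⟨?_, ?_⟩ ?_ ?_ ?_ ?_
  · exact fun z hz => congrArg Prod.snd (hk.1 (show (t, z) ∈ u ×ˢ s from ⟨ht, hz⟩))
  · intro z hz
    have := congrArg Prod.snd (hk.2 (show (t, z) ∈ u ×ˢ s from ⟨ht, hz⟩))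
    simpa only [hk1 z hz] using this
  · exact fun z hz => (hg.bijOn.mapsTo (show (t, z) ∈ u ×ˢ s from ⟨ht, hz⟩)).2
  · exact fun z hz => (hkm (show (t, z) ∈ u ×ˢ s from ⟨ht, hz⟩)).2
  · exact (contDiffOn_snd.comp hg.contDiffOn fun _ _ => mem_univ _).comp
      (contDiffOn_const.prodMk contDiffOn_id) fun z hz => ⟨ht, hz⟩
  · exact (contDiffOn_snd.comp hks fun _ _ => mem_univ _).comp
      (contDiffOn_const.prodMk contDiffOn_id) fun z hz => ⟨ht, hz⟩

/-! ### A ball in the complement of the surface, by Hausdorff dimension. -/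

/-- Read in a chart, a `C¹` map is locally Lipschitz, also at boundary points since the range of `I`
is convex, and Lipschitz maps do not raise Hausdorff dimension. -/
theorem ContMDiffAt.exists_mem_nhds_dimH_image_le {E F H M : Type*} [NormedAddCommGroup E]
    [NormedSpace ℝ E] [FiniteDimensional ℝ E] [NormedAddCommGroup F] [NormedSpace ℝ F]
    [TopologicalSpace H] {I : ModelWithCorners ℝ E H} [TopologicalSpace M] [ChartedSpace H M]
    {f : M → F} {x : M} (hf : ContMDiffAt I 𝓘(ℝ, F) 1 f x) :
    ∃ u ∈ 𝓝 x, dimH (f '' u) ≤ Module.finrank ℝ E := by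
  have h1 := (contMDiffAt_iff.1 hf).2
  obtain ⟨C, t, ht, hC⟩ := h1.exists_lipschitzOnWith I.convex_range
  rw [← map_extChartAt_nhds] at ht
  refine ⟨extChartAt I x ⁻¹' t ∩ (extChartAt I x).source,
    inter_mem ht (extChartAt_source_mem_nhds x), ?_⟩
  have hsub : f '' (extChartAt I x ⁻¹' t ∩ (extChartAt I x).source) ⊆
      (extChartAt 𝓘(ℝ, F) (f x) ∘ f ∘ (extChartAt I x).symm) '' t := by
    rintro _ ⟨y, ⟨hyt, hys⟩, rfl⟩
    exact ⟨extChartAt I x y, hyt, by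
      rw [Function.comp, Function.comp, (extChartAt I x).left_inv hys, extChartAt_self_apply,
        modelWithCornersSelf_coe, id]⟩
  exact (dimH_mono hsub).trans (hC.dimH_image_le.trans
    ((dimH_mono (subset_univ t)).trans (Real.dimH_univ_eq_finrank E).le))

/-- An embedded submanifold of positive codimension misses a ball near each of its points. -/
theorem Manifold.IsSmoothEmbedding.exists_ball_disjoint_range {E F H M : Type*}
    [NormedAddCommGroup E] [NormedSpace ℝ E] [FiniteDimensional ℝ E] [NormedAddCommGroup F]
    [NormedSpace ℝ F] [FiniteDimensional ℝ F] [TopologicalSpace H] {I : ModelWithCorners ℝ E H}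
    [TopologicalSpace M] [ChartedSpace H M] {n : ℕ∞ω} {f : M → F}
    (hf : IsSmoothEmbedding I 𝓘(ℝ, F) n f) (hn : 1 ≤ n)
    (hdim : Module.finrank ℝ E < Module.finrank ℝ F) {V : Set F} (hV : IsOpen V)
    (hVn : V.Nonempty) (hfV : ∀ x, f x ∈ closure V) :
    ∃ p ∈ V, ∃ r > 0, Disjoint (Metric.ball p r) (range f) := by
  rcases isEmpty_or_nonempty M with hM | ⟨⟨x⟩⟩
  · obtain ⟨p, hp⟩ := hVn
    exact ⟨p, hp, 1, one_pos, by simp [range_eq_empty]⟩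
  have : LocallyCompactSpace M := Manifold.locallyCompact_of_finiteDimensional I
  obtain ⟨u, hu, hdu⟩ := ((hf.isImmersion.contMDiff x).of_le hn).exists_mem_nhds_dimH_image_le
  -- The argument is local, as `M` need not be compact: `f '' K` is closed with dense complement,
  -- and because `f` is an embedding it contains the whole range of `f` near `f x`.
  obtain ⟨K, hK, hKu, hKc⟩ := local_compact_nhds hu
  have hKcl : IsClosed (f '' K) := (hKc.image hf.isEmbedding.continuous).isClosed
  have hnhds : f '' K ∈ 𝓝[range f] f x := by
    rw [← hf.isEmbedding.isInducing.map_nhds_eq]; exact image_mem_map hK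
  obtain ⟨U, hU, hxU, hUK⟩ := mem_nhdsWithin.1 hnhds
  have hdense : Dense (f '' K)ᶜ := dense_compl_of_dimH_lt_finrank
    ((dimH_mono (image_mono hKu)).trans_lt (hdu.trans_lt (by exact_mod_cast hdim)))
  obtain ⟨p, ⟨hpU, hpV⟩, hpK⟩ := hdense.inter_open_nonempty (U ∩ V) (hU.inter hV)
    (mem_closure_iff.1 (hfV x) U hU hxU)
  obtain ⟨r, hr, hball⟩ := Metric.isOpen_iff.1 (hU.inter hKcl.isOpen_compl) p ⟨hpU, hpK⟩
  refine ⟨p, hpV, r, hr, disjoint_left.2 fun y hy hyf => ?_⟩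
  exact (hball hy).2 (hUK ⟨(hball hy).1, hyf⟩)

theorem IsEmbeddingInD4.exists_ball_disjoint {H : Type*} [TopologicalSpace H]
    {I : ModelWithCorners ℝ (EuclideanSpace ℝ (Fin 2)) H}
    {S : Type*} [TopologicalSpace S] [ChartedSpace H S] {j : S → R4} (hj : IsEmbeddingInD4 I j) :
    ∃ (p : R4) (r : ℝ), 0 < r ∧ ‖p‖ + r ≤ 1 ∧ ∀ x, r ≤ ‖j x - p‖ := by
  obtain ⟨p, hp, r, hr, hd⟩ := hj.isSmoothEmbedding.exists_ball_disjoint_range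
    (V := Metric.ball 0 1) (by exact_mod_cast le_top) (by simp) Metric.isOpen_ball
    ⟨0, Metric.mem_ball_self one_pos⟩
    (fun x => by rw [closure_ball _ one_ne_zero]; exact hj.mem_D4 x)
  have hp1 : ‖p‖ < 1 := by simpa using hp
  refine ⟨p, min r (1 - ‖p‖), lt_min hr (by linarith), by
    linarith [min_le_right r (1 - ‖p‖)], fun x => ?_⟩
  refine (min_le_left _ _).trans (not_lt.1 fun h => ?_)
  exact disjoint_left.1 hd (by rwa [Metric.mem_ball, dist_eq_norm]) (mem_range_self x)

/-! ### Assembling the isotopy. -/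

/-- `S` is any smooth surface (without boundary, e.g. `I = 𝓡 2`, or with boundary, `I = 𝓡∂ 2`;
compactness is not needed). -/
theorem lemma2 {H : Type*} [TopologicalSpace H]
    (I : ModelWithCorners ℝ (EuclideanSpace ℝ (Fin 2)) H)
    {S : Type*} [TopologicalSpace S] [ChartedSpace H S] [IsManifold I ∞ S]
    (j j' : S → R4) (hj : IsEmbeddingInD4 I j) (hj' : IsEmbeddingInD4 I j')
    (α : R4 → R4) (hα : IsSmoothDiffeo D4 D4 α) (hbdry : ∀ z ∈ bdryD4, α z = z)
    (hjj' : ∀ x, j' x = α (j x)) :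
    IsotopicRelBdry j j' := by
  obtain ⟨p, r, hr, hpr, hdisj⟩ := hj.exists_ball_disjoint
  obtain ⟨ε, h, hε, hH, h1, h0, hsph, hid⟩ := exists_isotopy_to_eq_id_near_sphere hα hbdry
  obtain ⟨e, hes, hes', heD, heS⟩ := h1.exists_extension hε fun z _ => hid z
  have heS' : ∀ z, 1 ≤ ‖z‖ → e.symm z = z := fun w hw => by rw [Equiv.symm_apply_eq, heS w hw]
  have hΓ := isSmoothDiffeo_shrink e.symm heS' hes' hes hr hpr
  obtain ⟨k, hk, hks⟩ := hH.exists_symm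
  have hkh : ∀ t ∈ Icc (0 : ℝ) 1, ∀ z ∈ D4, k (t, h t z) = (t, z) := fun t ht z hz =>
    hk.1 (show (t, z) ∈ Icc (0 : ℝ) 1 ×ˢ Metric.closedBall (0 : R4) 1 from ⟨ht, hz⟩)
  have hk1 : ∀ q ∈ Icc (0 : ℝ) 1 ×ˢ D4, (k q).1 = q.1 := fun q hq => by
    have := congrArg Prod.fst (hk.2 hq)
    exact this
  have hγD : ∀ t ∈ Icc (0 : ℝ) 1, ∀ z ∈ D4, shrink e.symm p r t z ∈ D4 := fun t ht z hz =>
    (hΓ.bijOn.mapsTo (show (t, z) ∈ Icc (0 : ℝ) 1 ×ˢ Metric.closedBall (0 : R4) 1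
      from ⟨ht, hz⟩)).2
  have hI0 : (0 : ℝ) ∈ Icc (0 : ℝ) 1 := ⟨le_rfl, zero_le_one⟩
  have hI1 : (1 : ℝ) ∈ Icc (0 : ℝ) 1 := ⟨zero_le_one, le_rfl⟩
  have hbD : bdryD4 ⊆ D4 := Metric.sphere_subset_closedBall
  refine ⟨α ∘ shrink e.symm p r 1, hα.comp (hΓ.slice hI1), ?_, fun x => ?_⟩
  -- On slices this is `α ∘ (h t)⁻¹ ∘ h 1 ∘ γ t`. At `t = 0` the factors cancel in pairs, as `h 0 =
  -- α` and `γ 0 = e⁻¹`; at `t = 1` the middle two cancel.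
  · refine ⟨Prod.map id α ∘ k ∘ Prod.map id (h 1) ∘ fun q => (q.1, shrink e.symm p r q.1 q.2),
      (hα.prodMap_id _).comp (hks.comp ((h1.prodMap_id _).comp hΓ)), ?_, ?_, ?_, ?_⟩
    · intro t ht z hz
      exact hk1 (t, h 1 (shrink e.symm p r t z)) ⟨ht, h1.bijOn.mapsTo (hγD t ht z hz)⟩
    · intro z hz
      obtain ⟨w, hw, rfl⟩ := hα.bijOn.surjOn hz
      -- Needed because `e` agrees with `h 1` only on the ball.
      have hm : e.symm (α w) ∈ D4 := by
        have := hγD 0 hI0 (α w) hz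
        rwa [shrink_zero] at this
      simp only [Function.comp, Prod.map, id, shrink_zero]
      rw [← heD _ hm, e.apply_symm_apply, ← h0 w, hkh 0 hI0 w hw, h0]
    · intro z hz
      simp only [Function.comp, Prod.map, id]
      rw [hkh 1 hI1 _ (hγD 1 hI1 z hz)]
    · intro t ht z hz
      have hz1 : 1 ≤ ‖z‖ := (mem_sphere_zero_iff_norm.1 hz).ge
      simp only [Function.comp, Prod.map, id]
      rw [shrink_eq_self_of_one_le heS' hr hpr ht hz1, hsph 1 z hz]
      have := hkh t ht z (hbD hz)
      rw [hsph t z hz] at this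
      rw [this, hbdry z hz]
  · rw [Function.comp, shrink_eq_self heS' hr hI1 (by simpa using hdisj x), hjj' x]
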